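/- All graphs are simple and labeled, with vertex set $[n]=\{1,\dots,n\}$; graphs of diameter $d$, or of diameter at least $d$, are understood to be connected. Write $n_{(k)}=n(n-1)\cdots(n-k+1)$. For $d<n$ let $\mathcal{H}_2(n,d)$ be the class of graphs $G$ on $[n]$ for which there is an ordered partition $(V_0,V_1,\dots,V_d)$ of $[n]$ into parts of one or two elements such that $|V_0|=|V_1|=|V_2|=|V_{d-2}|=|V_{d-1}|=|V_d|=1$; no two consecutive parts both have two elements; every edge of $G$ lies inside some $V_i$ or joins a vertex of $V_{i-1}$ to a vertex of $V_i$ for some $1\le i\le d$; and for every $1\le i\le d$ each vertex of $V_i$ is adjacent to at least one vertex of $V_{i-1}$ (edges inside the parts are arbitrary). There is a constant $c_2>0$ such that for integers $n-c_2\log n<d<n$ and $n\to\infty$, uniformly in $d$, almost all connected $n$-vertex graphs of diameter at least $d$ belong to $\mathcal{H}_2(n,d)$ (that is, the proportion of those that do is $1-o(1)$), and the number of $n$-vertex graphs of diameter $d$ is $$(1+o(1))\,\tfrac12\, n_{(d+1)}\, d^{\,n-d-1}\, 3^{\,n-d-1}.$$ -/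

import Mathlib

/-- The class of (labeled) graphs with vertex set `{0, …, n - 1}` that are connected and have
diameter exactly `d`. -/
def graphsDiamEq (n d : ℕ) : Set (SimpleGraph (Fin n)) :=
  {G | G.Connected ∧ G.diam = d}

/-- The class of (labeled) graphs with vertex set `{0, …, n - 1}` that are connected and have
(finite) diameter at least `d`. -/
def graphsDiamGe (n d : ℕ) : Set (SimpleGraph (Fin n)) :=
  {G | G.Connected ∧ d ≤ G.diam}

/-- The part `V i` of the ordered partition of the vertex set given by the function `ℓ` which
sends a vertex to the index of its part. -/
def part {n : ℕ} (ℓ : Fin n → ℕ) (i : ℕ) : Finset (Fin n) :=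
  Finset.univ.filter fun v => ℓ v = i

/-- `IsSnakePartition G d ℓ`: with `V i = part ℓ i`, the graph `G` is one of the snake-like graphs
built on the ordered partition `(V 0, V 1, …, V d)` of its vertex set. -/
structure IsSnakePartition {n : ℕ} (G : SimpleGraph (Fin n)) (d : ℕ) (ℓ : Fin n → ℕ) : Prop where
  /-- The parts are `V 0, …, V d`. -/
  index_le : ∀ v, ℓ v ≤ d
  /-- Every part has one or two elements. -/
  card_part : ∀ i, i ≤ d → (part ℓ i).card = 1 ∨ (part ℓ i).card = 2
  /-- `V 0`, `V 1`, `V 2` and `V (d - 2)`, `V (d - 1)`, `V d` are singletons. -/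
  card_end : ∀ i, i ≤ d → (i ≤ 2 ∨ d ≤ i + 2) → (part ℓ i).card = 1
  /-- There are no two consecutive two-element parts. -/
  not_consecutive : ∀ i, i < d → (part ℓ i).card = 2 → (part ℓ (i + 1)).card = 1
  /-- Edges only run inside a part or between consecutive parts. -/
  adj_le : ∀ u v, G.Adj u v → ℓ v ≤ ℓ u + 1
  /-- Each vertex of `V i`, `1 ≤ i ≤ d`, is joined to at least one vertex of `V (i - 1)`. -/
  exists_adj : ∀ v, 1 ≤ ℓ v → ∃ u, ℓ u + 1 = ℓ v ∧ G.Adj u v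

/-- The class of snake-like graphs with vertex set `{0, …, n - 1}` and parameter `d`. -/
def snakeGraphs (n d : ℕ) : Set (SimpleGraph (Fin n)) :=
  {G | ∃ ℓ : Fin n → ℕ, IsSnakePartition G d ℓ}

/-- The main term `(1/2) n(n-1)⋯(n-d) d^(n-d-1) 3^(n-d-1)`, meant for `d < n`. -/
noncomputable def snakeCount (n d : ℕ) : ℝ :=
  1 / 2 * (n.descFactorial (d + 1) : ℝ) * (d : ℝ) ^ (n - d - 1) * 3 ^ (n - d - 1)

/-! The proof double counts pairs of a graph and a layering of its vertices by distance from an end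
of a diametral pair. Put k = n - d - 1, the number of vertices outside a geodesic of length d; here
k is at most a small multiple of log n.

For fixed layers, the compatible graphs are counted exactly by a product over layer sizes
(`card_isLayered`). A surjective layering is a section s, one vertex per layer, plus a map f placing
the surplus vertices; dividing by the number of sections removes the overcount
(`sum_surjective_eq`). An isolated surplus vertex below the top layer gives a two-element layer. Its
inner edge contributes a factor 2, which cancels the two choices of section, and the next layer's
vertex has 3 possible neighbourhoods in it. Hence the factor 3 per surplus vertex, with corrections
only from surplus vertices in equal or consecutive layers (`layerWeight_le`). These are negligible
on average, since a new vertex has at most 3k positions close to earlier ones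
(`sum_three_pow_closePairs_le`).

Upper bound: a graph of diameter m ≥ d has at least two distance layerings, one from each end of a
diametral pair (`two_mul_ncard_graphsDiamGe_le`). The sum over m is dominated by m = d
(`sum_pow_div_factorial_le`).

Lower bound: spread-out placements produce snake graphs, and a snake graph has a unique diametral
pair, so at most two snake partitions (`sum_card_isSnakePartition_le`). Snake graphs have diameter
exactly d, so the matching bounds squeeze all three classes. -/

/-! ### Counting graphs with prescribed layers. -/

/-- The graph `G` is compatible with the layers given by `ℓ`: edges only run inside a layer or
between consecutive layers, and each vertex outside layer `0` has a neighbour in the layer below. -/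
def IsLayered {n : ℕ} (G : SimpleGraph (Fin n)) (ℓ : Fin n → ℕ) : Prop :=
  (∀ u v, G.Adj u v → ℓ v ≤ ℓ u + 1) ∧ ∀ v, 1 ≤ ℓ v → ∃ u, ℓ u + 1 = ℓ v ∧ G.Adj u v

theorem mem_part {n : ℕ} {ℓ : Fin n → ℕ} {i : ℕ} {v : Fin n} : v ∈ part ℓ i ↔ ℓ v = i := by
  simp [part]

/-- The possible sets of neighbours of `v` in the layer below. -/
def downChoices {n : ℕ} (ℓ : Fin n → ℕ) (v : Fin n) : Finset (Finset (Fin n)) :=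
  if 1 ≤ ℓ v then (part ℓ (ℓ v - 1)).powerset.erase ∅ else {∅}

theorem mem_downChoices {n : ℕ} {ℓ : Fin n → ℕ} {v : Fin n} {A : Finset (Fin n)} :
    A ∈ downChoices ℓ v ↔ (∀ u ∈ A, ℓ u + 1 = ℓ v) ∧ (1 ≤ ℓ v → A.Nonempty) := by
  unfold downChoices
  split_ifs with h
  · rw [Finset.mem_erase, Finset.mem_powerset, Finset.subset_iff]
    simp only [mem_part, Finset.nonempty_iff_ne_empty]
    constructor
    · rintro ⟨h1, h2⟩
      exact ⟨fun u hu => by have := h2 hu; omega, fun _ => h1⟩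
    · rintro ⟨h1, h2⟩
      exact ⟨h2 h, fun u hu => by have := h1 u hu; omega⟩
  · rw [Finset.mem_singleton]
    constructor
    · rintro rfl
      exact ⟨by simp, fun h' => absurd h' h⟩
    · rintro ⟨h1, -⟩
      refine Finset.eq_empty_of_forall_notMem fun u hu => ?_
      have := h1 u hu
      omega

theorem card_downChoices {n : ℕ} (ℓ : Fin n → ℕ) (v : Fin n) :
    (downChoices ℓ v).card = if 1 ≤ ℓ v then 2 ^ (part ℓ (ℓ v - 1)).card - 1 else 1 := by
  unfold downChoices
  split_ifs with h
  · rw [Finset.card_erase_of_mem (Finset.empty_mem_powerset _), Finset.card_powerset]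
  · simp

/-- The pairs of vertices inside layer `i`. -/
def layerPairs {n : ℕ} (ℓ : Fin n → ℕ) (i : ℕ) : Finset (Sym2 (Fin n)) :=
  (part ℓ i).offDiag.image Sym2.mk.uncurry

theorem mk_mem_layerPairs {n : ℕ} {ℓ : Fin n → ℕ} {i : ℕ} {u v : Fin n} :
    s(u, v) ∈ layerPairs ℓ i ↔ ℓ u = i ∧ ℓ v = i ∧ u ≠ v := by
  simp only [layerPairs, Finset.mem_image, Finset.mem_offDiag, mem_part, Prod.exists]
  constructor
  · rintro ⟨a, b, ⟨h1, h2, h3⟩, h4⟩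
    rcases Sym2.eq_iff.1 h4 with ⟨rfl, rfl⟩ | ⟨rfl, rfl⟩
    · exact ⟨h1, h2, h3⟩
    · exact ⟨h2, h1, h3.symm⟩
  · rintro ⟨h1, h2, h3⟩
    exact ⟨u, v, ⟨h1, h2, h3⟩, rfl⟩

theorem card_layerPairs {n : ℕ} (ℓ : Fin n → ℕ) (i : ℕ) :
    (layerPairs ℓ i).card = (part ℓ i).card.choose 2 :=
  Sym2.card_image_offDiag _

/-- The graph with given sets of neighbours one layer below and given edges inside the layers. -/
def graphOfChoices {n m : ℕ} (A : Fin n → Finset (Fin n)) (B : Fin (m + 1) → Finset (Sym2 (Fin n))) :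
    SimpleGraph (Fin n) where
  Adj u v := u ≠ v ∧ (u ∈ A v ∨ v ∈ A u ∨ ∃ i, s(u, v) ∈ B i)
  symm := ⟨fun u v h => by
    refine ⟨h.1.symm, ?_⟩
    rw [Sym2.eq_swap]
    tauto⟩
  loopless := ⟨fun u h => h.1 rfl⟩

theorem graphOfChoices_adj {n m : ℕ} {A : Fin n → Finset (Fin n)}
    {B : Fin (m + 1) → Finset (Sym2 (Fin n))} {u v : Fin n} :
    (graphOfChoices A B).Adj u v ↔ u ≠ v ∧ (u ∈ A v ∨ v ∈ A u ∨ ∃ i, s(u, v) ∈ B i) :=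
  Iff.rfl

-- A layered graph amounts to independent choices: a nonempty set of lower neighbours for each
-- vertex above layer 0, and an arbitrary edge set inside each layer.
open Classical in
theorem card_isLayered {n m : ℕ} (ℓ : Fin n → ℕ) (hℓ : ∀ v, ℓ v ≤ m) :
    (Finset.univ.filter fun G : SimpleGraph (Fin n) => IsLayered G ℓ).card =
      (∏ i ∈ Finset.range m, (2 ^ (part ℓ i).card - 1) ^ (part ℓ (i + 1)).card) *
        ∏ i ∈ Finset.range (m + 1), 2 ^ (part ℓ i).card.choose 2 := by
  have hcard : (Fintype.piFinset (downChoices ℓ) ×ˢ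
      Fintype.piFinset fun i : Fin (m + 1) => (layerPairs ℓ i).powerset).card =
      (∏ i ∈ Finset.range m, (2 ^ (part ℓ i).card - 1) ^ (part ℓ (i + 1)).card) *
        ∏ i ∈ Finset.range (m + 1), 2 ^ (part ℓ i).card.choose 2 := by
    rw [Finset.card_product, Fintype.card_piFinset, Fintype.card_piFinset]
    congr 1
    · simp only [card_downChoices]
      rw [← Finset.prod_fiberwise_of_maps_to (s := Finset.univ) (t := Finset.range (m + 1)) (g := ℓ)
        (fun v _ => Finset.mem_range.2 (Nat.lt_succ_of_le (hℓ v))), Finset.prod_range_succ']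
      rw [Finset.prod_eq_one (s := Finset.univ.filter fun v => ℓ v = 0), mul_one]
      · refine Finset.prod_congr rfl fun i _ => ?_
        rw [Finset.prod_congr rfl (g := fun _ => 2 ^ (part ℓ i).card - 1), Finset.prod_const]
        · rfl
        · intro v hv
          simp [(Finset.mem_filter.1 hv).2]
      · intro v hv
        simp [(Finset.mem_filter.1 hv).2]
    · simp only [Finset.card_powerset, card_layerPairs]
      rw [Finset.prod_range fun i => 2 ^ (part ℓ i).card.choose 2]
  rw [← hcard]
  refine Finset.card_nbij'
    (fun G => (fun v => Finset.univ.filter fun u => ℓ u + 1 = ℓ v ∧ G.Adj u v,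
      fun i => (layerPairs ℓ i).filter fun e => e ∈ G.edgeSet))
    (fun p => graphOfChoices p.1 p.2) ?_ ?_ ?_ ?_
  · intro G hG
    have hG' : IsLayered G ℓ := by simpa using hG
    simp only [Finset.coe_product, Set.mem_prod, Finset.mem_coe, Fintype.mem_piFinset,
      mem_downChoices, Finset.mem_powerset]
    refine ⟨fun v => ⟨fun u hu => (Finset.mem_filter.1 hu).2.1, fun hv => ?_⟩, fun i =>
      Finset.filter_subset _ _⟩
    obtain ⟨u, hu⟩ := hG'.2 v hv
    exact ⟨u, by simpa using hu⟩
  · rintro ⟨A, B⟩ h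
    simp only [Finset.coe_product, Set.mem_prod, Finset.mem_coe, Fintype.mem_piFinset,
      mem_downChoices, Finset.mem_powerset] at h
    obtain ⟨hA, hB⟩ := h
    simp only [Finset.coe_filter, Finset.mem_univ, true_and, Set.mem_ofPred_eq]
    refine ⟨fun u v huv => ?_, fun v hv => ?_⟩
    · rcases huv.2 with h | h | ⟨i, h⟩
      · exact ((hA v).1 u h).ge
      · have := (hA u).1 v h
        omega
      · have := mk_mem_layerPairs.1 (hB i h)
        omega
    · obtain ⟨u, hu⟩ := (hA v).2 hv
      have := (hA v).1 u hu
      refine ⟨u, this, ?_, Or.inl hu⟩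
      rintro rfl
      omega
  · intro G hG
    have hG' : IsLayered G ℓ := by simpa using hG
    ext u v
    simp only [graphOfChoices, Finset.mem_filter, Finset.mem_univ, true_and, mk_mem_layerPairs,
      SimpleGraph.mem_edgeSet]
    constructor
    · rintro ⟨-, h | h | ⟨i, h⟩⟩
      · exact h.2
      · exact h.2.symm
      · exact h.2
    · intro h
      refine ⟨h.ne, ?_⟩
      have h1 := hG'.1 u v h
      have h2 := hG'.1 v u h.symm
      rcases lt_trichotomy (ℓ u) (ℓ v) with h3 | h3 | h3
      · exact Or.inl ⟨by omega, h⟩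
      · exact Or.inr (Or.inr ⟨⟨ℓ u, Nat.lt_succ_of_le (hℓ u)⟩, ⟨rfl, h3.symm, h.ne⟩, h⟩)
      · exact Or.inr (Or.inl ⟨by omega, h.symm⟩)
  · rintro ⟨A, B⟩ h
    simp only [Finset.coe_product, Set.mem_prod, Finset.mem_coe, Fintype.mem_piFinset,
      mem_downChoices, Finset.mem_powerset] at h
    obtain ⟨hA, hB⟩ := h
    refine Prod.ext (funext fun v => ?_) (funext fun i => ?_)
    · ext u
      simp only [graphOfChoices_adj, Finset.mem_filter, Finset.mem_univ, true_and]
      constructor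
      · rintro ⟨h, -, h1 | h1 | ⟨i, h1⟩⟩
        · exact h1
        · have := (hA u).1 v h1
          omega
        · have := mk_mem_layerPairs.1 (hB i h1)
          omega
      · intro h
        have := (hA v).1 u h
        refine ⟨this, ?_, Or.inl h⟩
        rintro rfl
        omega
    · ext e
      induction e with | _ u v
      simp only [graphOfChoices_adj, Finset.mem_filter, SimpleGraph.mem_edgeSet, mk_mem_layerPairs]
      constructor
      · rintro ⟨h, -, h1 | h1 | ⟨j, h1⟩⟩
        · have := (hA v).1 u h1
          omega
        · have := (hA u).1 v h1
          omega
        · have := mk_mem_layerPairs.1 (hB j h1)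
          have hij : i = j := Fin.ext (by omega)
          rwa [hij]
      · intro h
        have := mk_mem_layerPairs.1 (hB i h)
        exact ⟨this, this.2.2, Or.inr (Or.inr ⟨i, h⟩)⟩

/-! ### Surjections as a section plus surplus vertices. -/

/-- Labels the vertices outside the range of s by a fixed type, so that surplus placements range
over the same maps for every s. -/
theorem exists_sumEquiv_extending {ι κ V : Type*} [Fintype ι] [Fintype κ] [Fintype V]
    (hcard : Fintype.card V = Fintype.card ι + Fintype.card κ) (s : ι ↪ V) :
    ∃ e : ι ⊕ κ ≃ V, ∀ i, e (Sum.inl i) = s i := by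
  classical
  have h : Fintype.card κ = Fintype.card {v // v ∉ Set.range s} := by
    have h1 := Fintype.card_subtype_compl (fun v => v ∈ Set.range s)
    have h2 : Fintype.card {v // v ∈ Set.range s} = Fintype.card ι :=
      Set.card_range_of_injective s.injective
    omega
  let e₂ : κ ≃ {v // v ∉ Set.range s} := Fintype.equivOfCardEq h
  refine ⟨(Equiv.sumCongr (Equiv.ofInjective s s.injective) e₂).trans
    (Equiv.sumCompl (fun v => v ∈ Set.range s)), fun i => ?_⟩
  simp

open Classical in
theorem card_sections {ι V : Type*} [Fintype ι] [Fintype V] [DecidableEq ι] [DecidableEq V]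
    (ℓ : V → ι) :
    (Finset.univ.filter fun s : ι ↪ V => ∀ i, ℓ (s i) = i).card =
      ∏ i, (Finset.univ.filter fun v => ℓ v = i).card := by
  rw [← Fintype.card_piFinset]
  refine Finset.card_bij (fun s _ => s) ?_ ?_ ?_
  · intro s hs
    simpa [Fintype.mem_piFinset] using hs
  · intro s _ t _ h
    exact DFunLike.coe_injective h
  · intro s hs
    have hs' : ∀ i, ℓ (s i) = i := by simpa [Fintype.mem_piFinset] using hs
    exact ⟨⟨s, Function.LeftInverse.injective hs'⟩, by simpa using hs', rfl⟩

open Classical in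
/-- Double counting of pairs consisting of a surjection `ℓ` and a section `s` of it: the values of
`ℓ` outside the range of `s` form an arbitrary function `f`. -/
theorem sum_surjective_eq {ι κ V : Type*} [Fintype ι] [Fintype κ] [Fintype V] [DecidableEq ι]
    [DecidableEq κ] [DecidableEq V] [DecidablePred fun ℓ : V → ι => Function.Surjective ℓ]
    (E : (ι ↪ V) → (ι ⊕ κ ≃ V)) (hE : ∀ s i, E s (Sum.inl i) = s i) (F : (V → ι) → ℝ) :
    ∑ ℓ ∈ Finset.univ.filter (fun ℓ : V → ι => Function.Surjective ℓ), F ℓ =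
      ∑ s : ι ↪ V, ∑ f : κ → ι, F (Sum.elim id f ∘ (E s).symm) /
        ∏ i, (1 + ((Finset.univ.filter fun b => f b = i).card : ℝ)) := by
  -- Spread the value at ℓ evenly over its sections; their number is the product of the fibre sizes,
  -- nonzero by surjectivity.
  have h1 : ∀ ℓ ∈ Finset.univ.filter (fun ℓ : V → ι => Function.Surjective ℓ), F ℓ =
      ∑ s ∈ Finset.univ.filter fun s : ι ↪ V => ∀ i, ℓ (s i) = i,
        F ℓ / ∏ i, ((Finset.univ.filter fun v => ℓ v = i).card : ℝ) := by
    intro ℓ hℓ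
    have hsurj : Function.Surjective ℓ := by simpa using hℓ
    rw [Finset.sum_const, card_sections, nsmul_eq_mul, Nat.cast_prod, mul_div_cancel₀]
    refine Finset.prod_ne_zero_iff.2 fun i _ => ?_
    obtain ⟨v, hv⟩ := hsurj i
    exact Nat.cast_ne_zero.2 (Finset.card_ne_zero_of_mem (Finset.mem_filter.2 ⟨Finset.mem_univ v, hv⟩))
  rw [Finset.sum_congr rfl h1, Finset.sum_comm' (s' := fun s : ι ↪ V => Finset.univ.filter
    fun ℓ : V → ι => ∀ i, ℓ (s i) = i) (t' := Finset.univ)]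
  · refine Finset.sum_congr rfl fun s _ => ?_
    symm
    refine Finset.sum_bij (fun f _ => Sum.elim id f ∘ (E s).symm) ?_ ?_ ?_ ?_
    · intro f _
      simp only [Finset.mem_filter, Finset.mem_univ, true_and, Function.comp_apply, ← hE]
      simp
    · intro f _ g _ h
      funext b
      have := congrFun h (E s (Sum.inr b))
      simpa using this
    · intro ℓ hℓ
      have hℓ' : ∀ i, ℓ (s i) = i := by simpa using hℓ
      refine ⟨fun b => ℓ (E s (Sum.inr b)), Finset.mem_univ _, ?_⟩
      funext v
      obtain ⟨x, rfl⟩ := (E s).surjective v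
      rcases x with i | b
      · rw [Function.comp_apply, Equiv.symm_apply_apply, Sum.elim_inl, hE, hℓ', id]
      · simp
    · intro f _
      congr 1
      refine Finset.prod_congr rfl fun i _ => ?_
      have h : (Finset.univ.filter fun v => (Sum.elim id f ∘ (E s).symm) v = i).card =
          1 + (Finset.univ.filter fun b => f b = i).card := by
        rw [Finset.card_filter, Finset.card_filter, ← (E s).sum_comp, Fintype.sum_sum_type]
        simp
      rw [h]
      push_cast
      rfl
  · intro ℓ s
    simp only [Finset.mem_filter, Finset.mem_univ, true_and, and_true]
    exact ⟨fun h => h.2, fun h => ⟨fun i => ⟨s i, h i⟩, h⟩⟩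

/-! ### Edge weight in terms of the surplus per layer. -/

/-- The number of arguments at which `f` takes the value `i`. -/
def occ {k M : ℕ} (f : Fin k → Fin M) (i : ℕ) : ℕ :=
  (Finset.univ.filter fun b => (f b : ℕ) = i).card

theorem sum_occ {k m : ℕ} (f : Fin k → Fin (m + 1)) :
    ∑ i ∈ Finset.range (m + 1), occ f i = k := by
  have h := Finset.card_eq_sum_card_fiberwise (s := Finset.univ) (t := Finset.range (m + 1))
    (f := fun b => (f b : ℕ)) (fun b _ => by simp [Nat.lt_succ_iff.1 (f b).2])
  simpa [occ] using h.symm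

theorem card_part_sumElim {n k m : ℕ} (e : Fin (m + 1) ⊕ Fin k ≃ Fin n) (f : Fin k → Fin (m + 1))
    {i : ℕ} (hi : i ≤ m) :
    (part (fun v => ((Sum.elim id f ∘ e.symm) v : ℕ)) i).card = 1 + occ f i := by
  unfold part occ
  rw [Finset.card_filter, Finset.card_filter, ← e.sum_comp, Fintype.sum_sum_type]
  congr 1
  · rw [Finset.sum_eq_single ⟨i, Nat.lt_succ_of_le hi⟩]
    · simp
    · intro j _ hj
      have : (j : ℕ) ≠ i := fun h => hj (Fin.ext h)
      simp [this]
    · simp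
  · simp

theorem prod_one_add_occ {k m : ℕ} (f : Fin k → Fin (m + 1)) :
    ∏ i : Fin (m + 1), (1 + ((Finset.univ.filter fun b => f b = i).card : ℝ)) =
      ((∏ i ∈ Finset.range (m + 1), (1 + occ f i) : ℕ) : ℝ) := by
  rw [Finset.prod_range]
  push_cast
  refine Finset.prod_congr rfl fun i _ => ?_
  simp only [occ, Fin.ext_iff]

/-- The number of ways to choose the edges when the layers have the sizes `N i`. -/
def layerWeight (m : ℕ) (N : ℕ → ℕ) : ℕ :=
  (∏ i ∈ Finset.range m, (2 ^ N i - 1) ^ N (i + 1)) *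
    ∏ i ∈ Finset.range (m + 1), 2 ^ (N i).choose 2

theorem layerWeight_congr {m : ℕ} {N N' : ℕ → ℕ} (h : ∀ i, i ≤ m → N i = N' i) :
    layerWeight m N = layerWeight m N' := by
  unfold layerWeight
  congr 1
  · refine Finset.prod_congr rfl fun i hi => ?_
    have := Finset.mem_range.1 hi
    rw [h i (by omega), h (i + 1) (by omega)]
  · refine Finset.prod_congr rfl fun i hi => ?_
    have := Finset.mem_range.1 hi
    rw [h i (by omega)]

theorem two_pow_succ_sub_one_le (e : ℕ) : 2 ^ (1 + e) - 1 ≤ 3 ^ e := by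
  have : 2 ^ (1 + e) ≤ 3 ^ e + 1 := by
    induction e with
    | zero => norm_num
    | succ e ih =>
      have h3 : 1 ≤ 3 ^ e := Nat.one_le_pow _ _ (by norm_num)
      calc 2 ^ (1 + (e + 1)) = 2 * 2 ^ (1 + e) := by ring
        _ ≤ 2 * (3 ^ e + 1) := by gcongr
        _ ≤ 3 ^ (e + 1) + 1 := by rw [pow_succ]; omega
  exact Nat.sub_le_of_le_add this

/-- Equality holds for a surplus of 0 or 1, the only cases that matter asymptotically; otherwise the
excess is charged to ordered pairs of surplus vertices in the same layer. -/
theorem two_pow_choose_le (e : ℕ) : 2 ^ (1 + e).choose 2 ≤ (1 + e) * 3 ^ (e * (e - 1)) := by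
  induction e with
  | zero => norm_num
  | succ e ih =>
    rcases Nat.eq_zero_or_pos e with rfl | he
    · norm_num
    · have h1 : (1 + (e + 1)).choose 2 = (1 + e) + (1 + e).choose 2 := by
        rw [show 1 + (e + 1) = (1 + e) + 1 by ring, Nat.choose_succ_succ, Nat.choose_one_right]
      have h2 : (e + 1) * (e + 1 - 1) = e * (e - 1) + 2 * e := by
        obtain ⟨e', rfl⟩ : ∃ e', e = e' + 1 := ⟨e - 1, by omega⟩
        simp only [Nat.add_sub_cancel]
        ring
      have h3 : 2 ^ (1 + e) ≤ 3 ^ (2 * e) := by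
        calc 2 ^ (1 + e) ≤ 2 ^ (2 * e) := Nat.pow_le_pow_right (by norm_num) (by omega)
          _ ≤ 3 ^ (2 * e) := Nat.pow_le_pow_left (by norm_num) _
      rw [h1, h2, pow_add 2 (1 + e), pow_add 3]
      calc 2 ^ (1 + e) * 2 ^ (1 + e).choose 2
          ≤ 3 ^ (2 * e) * ((1 + e) * 3 ^ (e * (e - 1))) := Nat.mul_le_mul h3 ih
        _ = (1 + e) * (3 ^ (e * (e - 1)) * 3 ^ (2 * e)) := by ring
        _ ≤ _ := by gcongr; omega


/-- The three factors are the number of sections, 3 per surplus vertex, and a penalty for surplus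
vertices in the same or consecutive layers. -/
theorem layerWeight_le (m : ℕ) (e : ℕ → ℕ) :
    layerWeight m (fun i => 1 + e i) ≤ (∏ i ∈ Finset.range (m + 1), (1 + e i)) *
      (3 ^ (∑ i ∈ Finset.range (m + 1), e i) * 3 ^ (∑ i ∈ Finset.range m, e i * e (i + 1) +
        ∑ i ∈ Finset.range (m + 1), e i * (e i - 1))) := by
  have h1 : ∏ i ∈ Finset.range m, (2 ^ (1 + e i) - 1) ^ (1 + e (i + 1)) ≤
      3 ^ (∑ i ∈ Finset.range (m + 1), e i) * 3 ^ (∑ i ∈ Finset.range m, e i * e (i + 1)) := by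
    calc ∏ i ∈ Finset.range m, (2 ^ (1 + e i) - 1) ^ (1 + e (i + 1))
        ≤ ∏ i ∈ Finset.range m, 3 ^ (e i + e i * e (i + 1)) := by
          refine Finset.prod_le_prod' fun i _ => ?_
          calc (2 ^ (1 + e i) - 1) ^ (1 + e (i + 1)) ≤ (3 ^ e i) ^ (1 + e (i + 1)) :=
                Nat.pow_le_pow_left (two_pow_succ_sub_one_le _) _
            _ = _ := by rw [← pow_mul]; ring_nf
      _ = 3 ^ (∑ i ∈ Finset.range m, e i) * 3 ^ (∑ i ∈ Finset.range m, e i * e (i + 1)) := by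
          rw [Finset.prod_pow_eq_pow_sum, Finset.sum_add_distrib, pow_add]
      _ ≤ _ := by
          gcongr
          · norm_num
          · omega
  have h2 : ∏ i ∈ Finset.range (m + 1), 2 ^ (1 + e i).choose 2 ≤
      (∏ i ∈ Finset.range (m + 1), (1 + e i)) *
        3 ^ (∑ i ∈ Finset.range (m + 1), e i * (e i - 1)) := by
    rw [← Finset.prod_pow_eq_pow_sum, ← Finset.prod_mul_distrib]
    exact Finset.prod_le_prod' fun i _ => two_pow_choose_le _
  calc layerWeight m (fun i => 1 + e i) ≤ _ := Nat.mul_le_mul h1 h2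
    _ = _ := by rw [pow_add]; ring

/-- The top layer must carry no surplus: there is no layer above it to supply the factor 3. -/
theorem le_layerWeight (m : ℕ) (e : ℕ → ℕ) (he : ∀ i, e i ≤ 1) (hm : e m = 0) :
    (∏ i ∈ Finset.range (m + 1), (1 + e i)) * 3 ^ (∑ i ∈ Finset.range (m + 1), e i) ≤
      layerWeight m (fun i => 1 + e i) := by
  unfold layerWeight
  beta_reduce
  rw [mul_comm]
  refine Nat.mul_le_mul ?_ (Finset.prod_le_prod' fun i _ => ?_)
  · rw [Finset.sum_range_succ, hm, add_zero, ← Finset.prod_pow_eq_pow_sum]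
    refine Finset.prod_le_prod' fun i _ => ?_
    have h : 2 ^ (1 + e i) - 1 = 3 ^ e i := by
      rcases Nat.le_one_iff_eq_zero_or_eq_one.1 (he i) with h | h <;> rw [h] <;> norm_num
    rw [h]
    exact Nat.le_self_pow (by omega) _
  · rcases Nat.le_one_iff_eq_zero_or_eq_one.1 (he i) with h | h <;> rw [h] <;> norm_num

/-! ### Close pairs are rare on average. -/

/-- The number of ordered pairs of distinct arguments at which the values of `f` are equal or
consecutive. -/
def closePairs {k M : ℕ} (f : Fin k → Fin M) : ℕ :=
  (Finset.univ.filter fun p : Fin k × Fin k =>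
    p.1 ≠ p.2 ∧ (f p.1 : ℕ) ≤ f p.2 + 1 ∧ (f p.2 : ℕ) ≤ f p.1 + 1).card

theorem sum_occ_mul_le_closePairs {k m : ℕ} (f : Fin k → Fin (m + 1)) :
    ∑ i ∈ Finset.range m, occ f i * occ f (i + 1) +
      ∑ i ∈ Finset.range (m + 1), occ f i * (occ f i - 1) ≤ closePairs f := by
  have h1 : ∑ i ∈ Finset.range m, occ f i * occ f (i + 1) =
      (Finset.univ.filter fun p : Fin k × Fin k => (f p.1 : ℕ) + 1 = f p.2).card := by
    rw [Finset.card_eq_sum_card_fiberwise (t := Finset.range m) (f := fun p => (f p.1 : ℕ))]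
    · refine Finset.sum_congr rfl fun i _ => ?_
      rw [occ, occ, ← Finset.card_product]
      congr 1
      ext p
      simp only [Finset.mem_product, Finset.mem_filter, Finset.mem_univ, true_and]
      omega
    · intro p hp
      have := (Finset.mem_filter.1 hp).2
      have := (f p.2).2
      simp only [Finset.coe_range, Set.mem_Iio]
      omega
  have h2 : ∑ i ∈ Finset.range (m + 1), occ f i * (occ f i - 1) =
      (Finset.univ.filter fun p : Fin k × Fin k => p.1 ≠ p.2 ∧ (f p.1 : ℕ) = f p.2).card := by
    rw [Finset.card_eq_sum_card_fiberwise (t := Finset.range (m + 1)) (f := fun p => (f p.1 : ℕ))]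
    · refine Finset.sum_congr rfl fun i _ => ?_
      rw [occ, Nat.mul_sub, mul_one, ← Finset.offDiag_card]
      congr 1
      ext p
      simp only [Finset.mem_offDiag, Finset.mem_filter, Finset.mem_univ, true_and]
      omega
    · intro p _
      simp [Nat.lt_succ_iff.1 (f p.1).2]
  rw [h1, h2, ← Finset.card_union_of_disjoint]
  · refine Finset.card_le_card fun p hp => ?_
    simp only [Finset.mem_union, Finset.mem_filter, Finset.mem_univ, true_and] at hp ⊢
    rcases hp with h | h
    · refine ⟨?_, by omega, by omega⟩
      intro h'
      rw [h'] at h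
      omega
    · exact ⟨h.1, by omega, by omega⟩
  · rw [Finset.disjoint_filter]
    intro p _ h h'
    omega

/-- Closeness of two positions. -/
abbrev IsClose {M : ℕ} (x y : Fin M) : Prop := (x : ℕ) ≤ y + 1 ∧ (y : ℕ) ≤ x + 1

theorem card_isClose_le {M : ℕ} (x : Fin M) :
    (Finset.univ.filter fun y : Fin M => IsClose x y).card ≤ 3 := by
  have h : ((Finset.univ.filter fun y : Fin M => IsClose x y).map Fin.valEmbedding) ⊆
      Finset.Icc ((x : ℕ) - 1) (x + 1) := by
    intro i hi
    simp only [Finset.mem_map, Finset.mem_filter, Finset.mem_univ, true_and] at hi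
    obtain ⟨y, hy, rfl⟩ := hi
    simp only [Finset.mem_Icc, Fin.valEmbedding_apply]
    omega
  have := Finset.card_le_card h
  rw [Finset.card_map, Nat.card_Icc] at this
  omega

theorem card_exists_isClose_le {k M : ℕ} (f : Fin k → Fin M) :
    (Finset.univ.filter fun y : Fin M => ∃ b, IsClose (f b) y).card ≤ 3 * k := by
  have h : (Finset.univ.filter fun y : Fin M => ∃ b, IsClose (f b) y) ⊆
      Finset.univ.biUnion fun b => Finset.univ.filter fun y : Fin M => IsClose (f b) y := by
    intro y hy
    simpa using hy
  calc _ ≤ _ := Finset.card_le_card h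
    _ ≤ _ := Finset.card_biUnion_le
    _ ≤ ∑ _b : Fin k, 3 := Finset.sum_le_sum fun b _ => card_isClose_le _
    _ = 3 * k := by simp [mul_comm]

theorem closePairs_cons {k M : ℕ} (y : Fin M) (f : Fin k → Fin M) :
    closePairs (Fin.cons y f : Fin (k + 1) → Fin M) =
      closePairs f + 2 * (Finset.univ.filter fun b => IsClose (f b) y).card := by
  simp only [closePairs, Finset.card_filter, ← Finset.univ_product_univ, Finset.sum_product,
    Fin.sum_univ_succ, Fin.cons_zero, Fin.cons_succ, ne_eq, Fin.succ_inj, Fin.succ_ne_zero,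
    (Fin.succ_ne_zero _).symm, not_true, not_false_eq_true, false_and, true_and, if_false,
    Finset.sum_add_distrib, zero_add]
  have : ∀ b, (if (y : ℕ) ≤ f b + 1 ∧ (f b : ℕ) ≤ y + 1 then 1 else 0) =
      if (f b : ℕ) ≤ y + 1 ∧ (y : ℕ) ≤ f b + 1 then 1 else 0 := fun b => by
    simp only [and_comm]
  simp only [this]
  ring

theorem sum_fin_succ_arrow {k : ℕ} {α β : Type*} [Fintype α] [AddCommMonoid β]
    (F : (Fin (k + 1) → α) → β) :
    ∑ f, F f = ∑ f : Fin k → α, ∑ y : α, F (Fin.cons y f) := by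
  rw [← (Fin.consEquiv fun _ => α).sum_comp, Fintype.sum_prod_type, Finset.sum_comm]
  rfl

/-- Insert the points one at a time. A new point costs a factor 9 per earlier point close to it
(both orders count), hence at most `9 ^ K`, and only on at most `3 * K` positions; elsewhere it
costs nothing. -/
theorem sum_three_pow_closePairs_le (K M k : ℕ) (hk : k ≤ K) :
    ∑ f : Fin k → Fin M, 3 ^ closePairs f ≤ (M + 3 * K * 9 ^ K) ^ k := by
  induction k with
  | zero => simp [closePairs]
  | succ k ih =>
    rw [sum_fin_succ_arrow, pow_succ]
    calc ∑ f : Fin k → Fin M, ∑ y, 3 ^ closePairs (Fin.cons y f : Fin (k + 1) → Fin M)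
        ≤ ∑ f : Fin k → Fin M, 3 ^ closePairs f * (M + 3 * K * 9 ^ K) := by
          refine Finset.sum_le_sum fun f _ => ?_
          simp only [closePairs_cons, pow_add, ← Finset.mul_sum]
          refine Nat.mul_le_mul_left _ ?_
          calc ∑ y, 3 ^ (2 * (Finset.univ.filter fun b => IsClose (f b) y).card)
              ≤ ∑ y, (1 + if ∃ b, IsClose (f b) y then 9 ^ K else 0) := by
                refine Finset.sum_le_sum fun y _ => ?_
                split_ifs with h
                · rw [pow_mul]
                  refine le_trans (Nat.pow_le_pow_right (by norm_num) ?_) (Nat.le_add_left _ _)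
                  refine (Finset.card_filter_le _ _).trans ?_
                  simp only [Finset.card_univ, Fintype.card_fin]
                  omega
                · rw [Finset.filter_false_of_mem fun b _ hb => h ⟨b, hb⟩]
                  simp
            _ = M + (Finset.univ.filter fun y : Fin M => ∃ b, IsClose (f b) y).card * 9 ^ K := by
                rw [Finset.sum_add_distrib, Finset.card_eq_sum_ones, Finset.sum_mul,
                  Finset.sum_filter]
                simp
            _ ≤ _ := by
                gcongr
                exact (card_exists_isClose_le f).trans (by omega)
      _ = (∑ f : Fin k → Fin M, 3 ^ closePairs f) * (M + 3 * K * 9 ^ K) := by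
          rw [Finset.sum_mul]
      _ ≤ _ := Nat.mul_le_mul_right _ (ih (by omega))

/-! ### Spread placements of surplus vertices. -/

/-- The values of `f` keep away from each other and from the ends of `0, …, d`. -/
def IsSpread (d : ℕ) {k M : ℕ} (f : Fin k → Fin M) : Prop :=
  (∀ a, 3 ≤ (f a : ℕ) ∧ (f a : ℕ) + 3 ≤ d) ∧ ∀ a b, a ≠ b → ¬ IsClose (f a) (f b)

theorem isSpread_cons {d k M : ℕ} {y : Fin M} {f : Fin k → Fin M} :
    IsSpread d (Fin.cons y f : Fin (k + 1) → Fin M) ↔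
      IsSpread d f ∧ (3 ≤ (y : ℕ) ∧ (y : ℕ) + 3 ≤ d) ∧ ∀ b, ¬ IsClose (f b) y := by
  simp only [IsSpread, Fin.forall_fin_succ, Fin.cons_zero, Fin.cons_succ, ne_eq, Fin.succ_inj,
    Fin.succ_ne_zero, (Fin.succ_ne_zero _).symm, not_true, not_false_eq_true, IsEmpty.forall_iff,
    true_and, forall_const, IsClose]
  constructor
  · rintro ⟨⟨h1, h2⟩, h3, h4⟩
    exact ⟨⟨h2, fun a => (h4 a).2⟩, h1, fun b => (h4 b).1⟩
  · rintro ⟨⟨h2, h4⟩, h1, h3⟩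
    exact ⟨⟨h1, h2⟩, fun b => fun h => h3 b h.symm, fun a => ⟨h3 a, h4 a⟩⟩

-- Greedy choice: of the d - 5 positions away from the ends, each earlier point forbids at most 3.
open Classical in
theorem le_card_isSpread (K d k : ℕ) (hk : k ≤ K) :
    (d - 5 - 3 * K) ^ k ≤
      (Finset.univ.filter fun f : Fin k → Fin (d + 1) => IsSpread d f).card := by
  induction k with
  | zero => simp [IsSpread]
  | succ k ih =>
    rw [Finset.card_filter, sum_fin_succ_arrow, pow_succ]
    calc _ ≤ (Finset.univ.filter fun f : Fin k → Fin (d + 1) => IsSpread d f).card *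
          (d - 5 - 3 * K) := Nat.mul_le_mul_right _ (ih (by omega))
      _ = ∑ f : Fin k → Fin (d + 1), if IsSpread d f then d - 5 - 3 * K else 0 := by
        rw [← Finset.sum_filter, Finset.sum_const, smul_eq_mul]
      _ ≤ _ := by
        refine Finset.sum_le_sum fun f _ => ?_
        simp only [isSpread_cons]
        split_ifs with hf
        · simp only [hf, true_and]
          rw [← Finset.card_filter]
          have h1 : (Finset.univ.filter fun y : Fin (d + 1) =>
              3 ≤ (y : ℕ) ∧ (y : ℕ) + 3 ≤ d).card = d - 5 := by
            rw [← Finset.card_map Fin.valEmbedding]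
            have : (Finset.univ.filter fun y : Fin (d + 1) =>
              3 ≤ (y : ℕ) ∧ (y : ℕ) + 3 ≤ d).map Fin.valEmbedding = Finset.Ico 3 (d - 2) := by
              ext i
              simp only [Finset.mem_map, Finset.mem_filter, Finset.mem_univ, true_and,
                Finset.mem_Ico, Fin.valEmbedding_apply]
              constructor
              · rintro ⟨y, hy, rfl⟩
                omega
              · intro hi
                exact ⟨⟨i, by omega⟩, ⟨hi.1, by simp only; omega⟩, rfl⟩
            rw [this, Nat.card_Ico]
            omega
          have h2 := card_exists_isClose_le f
          have h3 : (Finset.univ.filter fun y : Fin (d + 1) =>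
              3 ≤ (y : ℕ) ∧ (y : ℕ) + 3 ≤ d) \
              (Finset.univ.filter fun y : Fin (d + 1) => ∃ b, IsClose (f b) y) =
              Finset.univ.filter fun y : Fin (d + 1) =>
                (3 ≤ (y : ℕ) ∧ (y : ℕ) + 3 ≤ d) ∧ ∀ b, ¬ IsClose (f b) y := by
            ext y
            simp only [Finset.mem_sdiff, Finset.mem_filter, Finset.mem_univ, true_and, not_exists]
          have h4 := Finset.le_card_sdiff (Finset.univ.filter fun y : Fin (d + 1) =>
            ∃ b, IsClose (f b) y) (Finset.univ.filter fun y : Fin (d + 1) =>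
              3 ≤ (y : ℕ) ∧ (y : ℕ) + 3 ≤ d)
          rw [h3] at h4
          omega
        · exact Nat.zero_le _

/-! ### Distances in layered graphs and rigidity of snake partitions. -/

namespace IsLayered

variable {n : ℕ} {G : SimpleGraph (Fin n)} {ℓ : Fin n → ℕ}

theorem le_add_length (h : IsLayered G ℓ) {u v : Fin n} (p : G.Walk u v) :
    ℓ v ≤ ℓ u + p.length := by
  induction p with
  | nil => simp
  | cons hadj p ih =>
    have := h.1 _ _ hadj
    rw [SimpleGraph.Walk.length_cons]
    omega

theorem le_add_dist (h : IsLayered G ℓ) (hc : G.Connected) (u v : Fin n) :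
    ℓ v ≤ ℓ u + G.dist u v := by
  obtain ⟨p, hp⟩ := hc.exists_walk_length_eq_dist u v
  rw [← hp]
  exact h.le_add_length p

theorem exists_below (h : IsLayered G ℓ) (j : ℕ) (v : Fin n) (hj : j ≤ ℓ v) :
    ∃ u, ℓ u + j = ℓ v ∧ ∃ p : G.Walk u v, p.length = j := by
  induction j generalizing v with
  | zero => exact ⟨v, rfl, SimpleGraph.Walk.nil, rfl⟩
  | succ j ih =>
    obtain ⟨w, hw, hadj⟩ := h.2 v (by omega)
    obtain ⟨u, hu, p, hp⟩ := ih w (by omega)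
    exact ⟨u, by omega, p.concat hadj, by rw [SimpleGraph.Walk.length_concat, hp]⟩

end IsLayered

namespace IsSnakePartition

variable {n d : ℕ} {G : SimpleGraph (Fin n)} {ℓ ℓ' : Fin n → ℕ}

theorem isLayered (h : IsSnakePartition G d ℓ) : IsLayered G ℓ := ⟨h.adj_le, h.exists_adj⟩

theorem exists_of_le (h : IsSnakePartition G d ℓ) {i : ℕ} (hi : i ≤ d) : ∃ v, ℓ v = i := by
  have : 0 < (part ℓ i).card := by rcases h.card_part i hi with h | h <;> omega
  obtain ⟨v, hv⟩ := Finset.card_pos.1 this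
  exact ⟨v, mem_part.1 hv⟩

theorem eq_of_card_part_eq_one {i : ℕ} (hi : (part ℓ i).card = 1) {u v : Fin n}
    (hu : ℓ u = i) (hv : ℓ v = i) : u = v :=
  Finset.card_le_one.1 hi.le u (mem_part.2 hu) v (mem_part.2 hv)

theorem card_part_zero (h : IsSnakePartition G d ℓ) : (part ℓ 0).card = 1 :=
  h.card_end 0 (Nat.zero_le _) (by omega)

theorem card_part_last (h : IsSnakePartition G d ℓ) : (part ℓ d).card = 1 :=
  h.card_end d le_rfl (by omega)

theorem connected (h : IsSnakePartition G d ℓ) : G.Connected := by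
  obtain ⟨x, hx⟩ := h.exists_of_le (Nat.zero_le d)
  have hr : ∀ v, G.Reachable x v := fun v => by
    obtain ⟨u, hu, p, -⟩ := h.isLayered.exists_below (ℓ v) v le_rfl
    rw [eq_of_card_part_eq_one h.card_part_zero hx (show ℓ u = 0 by omega)]
    exact p.reachable
  have : Nonempty (Fin n) := ⟨x⟩
  exact ⟨fun u v => (hr u).symm.trans (hr v)⟩

theorem dist_le_of_card_part_eq_one (h : IsSnakePartition G d ℓ) {u v : Fin n}
    (hu : (part ℓ (ℓ u)).card = 1) (huv : ℓ u ≤ ℓ v) : G.dist u v ≤ ℓ v - ℓ u := by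
  obtain ⟨w, hw, p, hp⟩ := h.isLayered.exists_below (ℓ v - ℓ u) v (Nat.sub_le _ _)
  obtain rfl := eq_of_card_part_eq_one hu rfl (show ℓ w = ℓ u by omega)
  rw [← hp]
  exact SimpleGraph.dist_le p

theorem eq_dist (h : IsSnakePartition G d ℓ) {x : Fin n} (hx : ℓ x = 0) :
    ℓ = fun v => G.dist x v := by
  funext v
  refine le_antisymm ?_ ?_
  · have := h.isLayered.le_add_dist h.connected x v
    omega
  · have := h.dist_le_of_card_part_eq_one (u := x) (v := v) (hx ▸ h.card_part_zero) (by omega)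
    omega

/-- From a singleton layer one descends from v straight to u. Otherwise the layer below u is a
singleton, and a detour through it costs 2 more; since then u lies in layer 3 or higher, the
distance stays below d. -/
theorem dist_le_and_eq_imp (h : IsSnakePartition G d ℓ) {u v : Fin n} (huv : ℓ u ≤ ℓ v) :
    G.dist u v ≤ d ∧ (G.dist u v = d → ℓ u = 0 ∧ ℓ v = d) := by
  have hv := h.index_le v
  rcases h.card_part (ℓ u) (h.index_le u) with h1 | h2
  · have := h.dist_le_of_card_part_eq_one h1 huv
    omega
  · have h3 : ¬ (ℓ u ≤ 2 ∨ d ≤ ℓ u + 2) := fun h' => by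
      have := h.card_end (ℓ u) (h.index_le u) h'
      omega
    obtain ⟨w, hw, p, hp⟩ := h.isLayered.exists_below 1 u (by omega)
    have h4 : (part ℓ (ℓ w)).card = 1 := by
      rcases h.card_part (ℓ w) (h.index_le w) with h5 | h5
      · exact h5
      · have := h.not_consecutive (ℓ w) (by omega) h5
        rw [hw] at this
        omega
    have h6 := h.dist_le_of_card_part_eq_one h4 (show ℓ w ≤ ℓ v by omega)
    have h7 := h.dist_le_of_card_part_eq_one h4 (show ℓ w ≤ ℓ u by omega)
    have h8 := h.connected.dist_triangle (u := u) (v := w) (w := v)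
    rw [SimpleGraph.dist_comm (u := u) (v := w)] at h8
    omega

theorem ediam_ne_top (h : IsSnakePartition G d ℓ) : G.ediam ≠ ⊤ := by
  obtain ⟨x, -⟩ := h.exists_of_le (Nat.zero_le d)
  have : Nonempty (Fin n) := ⟨x⟩
  exact SimpleGraph.connected_iff_ediam_ne_top.1 h.connected

theorem diam_eq (h : IsSnakePartition G d ℓ) : G.diam = d := by
  obtain ⟨x, hx⟩ := h.exists_of_le (Nat.zero_le d)
  obtain ⟨y, hy⟩ := h.exists_of_le (le_refl d)
  have : Nonempty (Fin n) := ⟨x⟩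
  refine le_antisymm ?_ ?_
  · obtain ⟨u, v, huv⟩ := G.exists_dist_eq_diam
    rw [← huv]
    rcases le_total (ℓ u) (ℓ v) with h1 | h1
    · exact (h.dist_le_and_eq_imp h1).1
    · rw [SimpleGraph.dist_comm]
      exact (h.dist_le_and_eq_imp h1).1
  · refine le_trans ?_ (SimpleGraph.dist_le_diam h.ediam_ne_top (u := x) (v := y))
    have := h.isLayered.le_add_dist h.connected x y
    omega

/-- Every snake partition is the distance function from its bottom vertex, which is an end of a
diametral pair, and {x, y} is the only such pair. -/
theorem eq_or_eq (h : IsSnakePartition G d ℓ) (h' : IsSnakePartition G d ℓ') {x y : Fin n}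
    (hx : ℓ x = 0) (hy : ℓ y = d) : ℓ' = (fun v => G.dist x v) ∨ ℓ' = fun v => G.dist y v := by
  obtain ⟨x', hx'⟩ := h'.exists_of_le (Nat.zero_le d)
  obtain ⟨y', hy'⟩ := h'.exists_of_le (le_refl d)
  have hd : G.dist x' y' = d := by
    rw [← hy', h'.eq_dist hx']
  rcases le_total (ℓ x') (ℓ y') with h1 | h1
  · have := ((h.dist_le_and_eq_imp h1).2 hd).1
    rw [eq_of_card_part_eq_one h.card_part_zero hx this]
    exact Or.inl (h'.eq_dist hx')
  · rw [SimpleGraph.dist_comm] at hd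
    have := ((h.dist_le_and_eq_imp h1).2 hd).2
    rw [eq_of_card_part_eq_one h.card_part_last hy this]
    exact Or.inr (h'.eq_dist hx')

end IsSnakePartition

theorem snakeGraphs_subset_graphsDiamEq (n d : ℕ) : snakeGraphs n d ⊆ graphsDiamEq n d := by
  rintro G ⟨ℓ, h⟩
  exact ⟨h.connected, h.diam_eq⟩

theorem graphsDiamEq_subset_graphsDiamGe (n d : ℕ) : graphsDiamEq n d ⊆ graphsDiamGe n d := by
  rintro G ⟨h1, h2⟩
  exact ⟨h1, h2.ge⟩

open Classical in
theorem sum_card_isSnakePartition_le (n d : ℕ) :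
    ∑ ℓ : Fin n → Fin (d + 1), (Finset.univ.filter fun G : SimpleGraph (Fin n) =>
      IsSnakePartition G d fun v => ℓ v).card ≤ 2 * (snakeGraphs n d).ncard := by
  have h1 : (snakeGraphs n d).ncard = (Finset.univ.filter fun G => G ∈ snakeGraphs n d).card := by
    rw [← Set.ncard_coe_finset]
    simp
  rw [h1]
  simp only [Finset.card_filter]
  rw [Finset.sum_comm, Finset.mul_sum]
  refine Finset.sum_le_sum fun G _ => ?_
  rw [← Finset.card_filter]
  by_cases hG : G ∈ snakeGraphs n d
  · obtain ⟨ℓ, h⟩ := hG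
    obtain ⟨x, hx⟩ := h.exists_of_le (Nat.zero_le d)
    obtain ⟨y, hy⟩ := h.exists_of_le (le_refl d)
    have hsub : ((Finset.univ.filter fun ℓ : Fin n → Fin (d + 1) =>
        IsSnakePartition G d fun v => ℓ v).image fun ℓ v => (ℓ v : ℕ)) ⊆
        {(fun v => G.dist x v), fun v => G.dist y v} := by
      intro ℓ' hℓ'
      obtain ⟨ℓ'', h', rfl⟩ := Finset.mem_image.1 hℓ'
      simpa using h.eq_or_eq (Finset.mem_filter.1 h').2 hx hy
    have hcard := (Finset.card_le_card hsub).trans Finset.card_le_two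
    rw [Finset.card_image_of_injective] at hcard
    · rw [if_pos ⟨ℓ, h⟩]
      exact hcard
    · intro a b hab
      funext v
      exact Fin.ext (congrFun hab v)
  · rw [if_neg hG, Finset.filter_false_of_mem fun ℓ _ h => hG ⟨_, h⟩]
    simp

/-! ### Distance layerings of graphs of large diameter. -/

theorem isLayered_dist {n : ℕ} {G : SimpleGraph (Fin n)} (hc : G.Connected) (x : Fin n) :
    IsLayered G fun v => G.dist x v := by
  have hadj : ∀ u v, G.Adj u v → G.dist x v ≤ G.dist x u + 1 := fun u v h => by
    have := hc.dist_triangle (u := x) (v := u) (w := v)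
    rwa [SimpleGraph.dist_eq_one_iff_adj.2 h] at this
  refine ⟨hadj, fun v hv => ?_⟩
  obtain ⟨p, hp⟩ := hc.exists_walk_length_eq_dist v x
  cases p with
  | nil => simp at hv
  | @cons _ u _ h q =>
    refine ⟨u, ?_, h.symm⟩
    have h1 := SimpleGraph.dist_le q
    have h2 := hadj _ _ h.symm
    rw [SimpleGraph.Walk.length_cons, SimpleGraph.dist_comm (u := v)] at hp
    rw [SimpleGraph.dist_comm] at h1
    simp only at hv ⊢
    omega

open Classical in
theorem two_mul_ncard_graphsDiamGe_le (n d : ℕ) (hd : 1 ≤ d) :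
    2 * (graphsDiamGe n d).ncard ≤ ∑ m ∈ Finset.Ico d n,
      ∑ ℓ ∈ Finset.univ.filter (fun ℓ : Fin n → Fin (m + 1) => Function.Surjective ℓ),
        (Finset.univ.filter fun G : SimpleGraph (Fin n) => IsLayered G fun v => ℓ v).card := by
  have h1 : (graphsDiamGe n d).ncard =
      (Finset.univ.filter fun G => G ∈ graphsDiamGe n d).card := by
    rw [← Set.ncard_coe_finset]
    simp
  rw [h1]
  simp only [Finset.card_filter]
  have h2 : ∀ m ∈ Finset.Ico d n,
      ∑ ℓ ∈ Finset.univ.filter (fun ℓ : Fin n → Fin (m + 1) => Function.Surjective ℓ),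
        (∑ G : SimpleGraph (Fin n), if IsLayered G fun v => ℓ v then 1 else 0) =
      ∑ G : SimpleGraph (Fin n), ((Finset.univ.filter fun ℓ : Fin n → Fin (m + 1) =>
        Function.Surjective ℓ).filter fun ℓ => IsLayered G fun v => ℓ v).card := by
    intro m _
    rw [Finset.sum_comm]
    refine Finset.sum_congr rfl fun G _ => ?_
    rw [Finset.card_filter]
  rw [Finset.sum_congr rfl h2, Finset.sum_comm, Finset.mul_sum]
  refine Finset.sum_le_sum fun G _ => ?_
  split_ifs with hG
  · obtain ⟨hc, hdiam⟩ := hG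
    have := hc.nonempty
    have hne : G.ediam ≠ ⊤ := SimpleGraph.connected_iff_ediam_ne_top.1 hc
    obtain ⟨x, y, hxy⟩ := G.exists_dist_eq_diam
    have hle : ∀ u v, G.dist u v < G.diam + 1 := fun u v =>
      Nat.lt_succ_of_le (SimpleGraph.dist_le_diam hne)
    let L : Fin n → Fin n → Fin (G.diam + 1) := fun u v => ⟨G.dist u v, hle u v⟩
    have hsurj : ∀ u v, G.dist u v = G.diam → Function.Surjective (L u) := by
      intro u v huv i
      obtain ⟨w, hw, -⟩ := (isLayered_dist hc u).exists_below (G.diam - i) v (Nat.sub_le_of_le_add (by omega))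
      have := i.2
      exact ⟨w, Fin.ext (by simp only [L] at hw ⊢; omega)⟩
    have hlt : G.diam < n := by
      have := Fintype.card_le_of_surjective _ (hsurj x y hxy)
      simpa using this
    refine le_trans ?_ (Finset.single_le_sum (f := fun m =>
      ((Finset.univ.filter fun ℓ : Fin n → Fin (m + 1) => Function.Surjective ℓ).filter
        fun ℓ => IsLayered G fun v => ℓ v).card) (fun _ _ => Nat.zero_le _)
      (Finset.mem_Ico.2 ⟨hdiam, hlt⟩))
    have hmem : ∀ u v, G.dist u v = G.diam → L u ∈ ((Finset.univ.filter
        fun ℓ : Fin n → Fin (G.diam + 1) => Function.Surjective ℓ).filter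
        fun ℓ => IsLayered G fun v => ℓ v) := fun u v huv =>
      Finset.mem_filter.2 ⟨Finset.mem_filter.2 ⟨Finset.mem_univ _, hsurj u v huv⟩,
        isLayered_dist hc u⟩
    rw [mul_one]
    -- The layerings from x and y differ at y, with values the diameter and 0; this needs d ≥ 1.
    refine Finset.one_lt_card.2 ⟨L x, hmem x y hxy, L y, hmem y x ?_, ?_⟩
    · rw [SimpleGraph.dist_comm, hxy]
    · intro h
      have := congrArg Fin.val (congrFun h y)
      simp only [L, SimpleGraph.dist_self] at this
      omega
  · exact Nat.zero_le _

/-! ### Upper and lower bounds on the double counts. -/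

open Classical in
theorem card_isLayered_sumElim {n k m : ℕ} (e : Fin (m + 1) ⊕ Fin k ≃ Fin n)
    (f : Fin k → Fin (m + 1)) :
    (Finset.univ.filter fun G : SimpleGraph (Fin n) =>
      IsLayered G fun v => ((Sum.elim id f ∘ e.symm) v : ℕ)).card =
      layerWeight m fun i => 1 + occ f i := by
  rw [card_isLayered (m := m) _ fun v => Nat.lt_succ_iff.1 (Fin.is_lt _)]
  exact layerWeight_congr fun i hi => card_part_sumElim e f hi

-- The uniform bound `K` on the surplus keeps the correction term independent of m, as needed when
-- summing over all diameters.
open Classical in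
theorem sum_card_isLayered_le {n k m K : ℕ} (hn : n = m + 1 + k) (hk : k ≤ K) :
    ∑ ℓ ∈ Finset.univ.filter (fun ℓ : Fin n → Fin (m + 1) => Function.Surjective ℓ),
      ((Finset.univ.filter fun G : SimpleGraph (Fin n) => IsLayered G fun v => ℓ v).card : ℝ) ≤
      n.descFactorial (m + 1) * (3 * ((m + 1 : ℕ) + 3 * K * 9 ^ K)) ^ k := by
  choose E hE using exists_sumEquiv_extending (ι := Fin (m + 1)) (κ := Fin k) (V := Fin n)
    (by simpa using hn)
  rw [sum_surjective_eq E hE fun ℓ => ((Finset.univ.filter fun G : SimpleGraph (Fin n) =>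
    IsLayered G fun v => ℓ v).card : ℝ)]
  have h1 : ∀ s : Fin (m + 1) ↪ Fin n, ∑ f : Fin k → Fin (m + 1),
      ((Finset.univ.filter fun G : SimpleGraph (Fin n) =>
        IsLayered G fun v => ((Sum.elim id f ∘ (E s).symm) v : ℕ)).card : ℝ) /
        ∏ i, (1 + ((Finset.univ.filter fun b => f b = i).card : ℝ)) ≤
      (3 * ((m + 1 : ℕ) + 3 * K * 9 ^ K)) ^ k := by
    intro s
    calc _ ≤ ∑ f : Fin k → Fin (m + 1), (3 : ℝ) ^ k * ((3 ^ closePairs f : ℕ) : ℝ) := by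
          refine Finset.sum_le_sum fun f _ => ?_
          rw [card_isLayered_sumElim, prod_one_add_occ, div_le_iff₀]
          · have h2 := layerWeight_le m (occ f)
            rw [sum_occ] at h2
            have h3 : 3 ^ (∑ i ∈ Finset.range m, occ f i * occ f (i + 1) +
                ∑ i ∈ Finset.range (m + 1), occ f i * (occ f i - 1)) ≤ 3 ^ closePairs f :=
              Nat.pow_le_pow_right (by norm_num) (sum_occ_mul_le_closePairs f)
            have h4 := h2.trans (Nat.mul_le_mul_left _ (Nat.mul_le_mul_left (3 ^ k) h3))
            rw [mul_comm]
            exact_mod_cast h4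
          · exact_mod_cast Finset.prod_pos fun i _ => by omega
      _ = (3 : ℝ) ^ k * ((∑ f : Fin k → Fin (m + 1), 3 ^ closePairs f : ℕ) : ℝ) := by
          rw [← Finset.mul_sum, Nat.cast_sum]
      _ ≤ (3 : ℝ) ^ k * (((m + 1 + 3 * K * 9 ^ K) ^ k : ℕ) : ℝ) := by
          gcongr
          exact sum_three_pow_closePairs_le K (m + 1) k hk
      _ = _ := by
          rw [mul_pow]
          push_cast
          rfl
  calc _ ≤ ∑ _s : Fin (m + 1) ↪ Fin n, (3 * (((m + 1 : ℕ) : ℝ) + 3 * K * 9 ^ K)) ^ k :=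
        Finset.sum_le_sum fun s _ => h1 s
    _ = _ := by
        rw [Finset.sum_const, Finset.card_univ, Fintype.card_embedding_eq, nsmul_eq_mul]
        simp

theorem IsSpread.occ_add_occ_le {d k M : ℕ} {f : Fin k → Fin M} (hf : IsSpread d f) (i : ℕ) :
    occ f i + occ f (i + 1) ≤ 1 := by
  rw [occ, occ, ← Finset.card_union_of_disjoint (Finset.disjoint_filter.2 fun b _ h h' => by omega)]
  refine Finset.card_le_one.2 fun a ha b hb => ?_
  simp only [Finset.mem_union, Finset.mem_filter, Finset.mem_univ, true_and] at ha hb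
  by_contra hab
  exact hf.2 a b hab (by unfold IsClose; omega)

theorem IsSpread.occ_eq_zero {d k M : ℕ} {f : Fin k → Fin M} (hf : IsSpread d f) {i : ℕ}
    (hi : i ≤ 2 ∨ d ≤ i + 2) : occ f i = 0 := by
  rw [occ, Finset.card_eq_zero, Finset.filter_eq_empty_iff]
  intro b _ hb
  have := hf.1 b
  omega

theorem IsLayered.isSnakePartition {n d k : ℕ} {G : SimpleGraph (Fin n)} {ℓ : Fin n → ℕ}
    (h : IsLayered G ℓ) (hd : ∀ v, ℓ v ≤ d) {f : Fin k → Fin (d + 1)} (hf : IsSpread d f)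
    (hpart : ∀ i, i ≤ d → (part ℓ i).card = 1 + occ f i) : IsSnakePartition G d ℓ where
  index_le := hd
  card_part i hi := by
    have := hf.occ_add_occ_le i
    rw [hpart i hi]
    omega
  card_end i hi hi' := by rw [hpart i hi, hf.occ_eq_zero hi']
  not_consecutive i hi h2 := by
    have := hf.occ_add_occ_le i
    rw [hpart i hi.le] at h2
    rw [hpart (i + 1) hi]
    omega
  adj_le := h.1
  exists_adj := h.2

-- Only spread f are kept: every layered graph over such an f is a snake graph, and its weight
-- divided by the number of sections is at least `3 ^ k`.
open Classical in
theorem le_sum_card_isSnakePartition {n k d : ℕ} (hn : n = d + 1 + k) :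
    (n.descFactorial (d + 1) : ℝ) * (3 * (d - 5 - 3 * k : ℕ)) ^ k ≤
      ∑ ℓ : Fin n → Fin (d + 1), ((Finset.univ.filter fun G : SimpleGraph (Fin n) =>
        IsSnakePartition G d fun v => ℓ v).card : ℝ) := by
  refine le_trans ?_ (Finset.sum_le_sum_of_subset_of_nonneg (Finset.filter_subset
    (fun ℓ : Fin n → Fin (d + 1) => Function.Surjective ℓ) _) fun _ _ _ => Nat.cast_nonneg _)
  choose E hE using exists_sumEquiv_extending (ι := Fin (d + 1)) (κ := Fin k) (V := Fin n)
    (by simpa using hn)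
  rw [sum_surjective_eq E hE fun ℓ => ((Finset.univ.filter fun G : SimpleGraph (Fin n) =>
    IsSnakePartition G d fun v => ℓ v).card : ℝ)]
  have h1 : ∀ s : Fin (d + 1) ↪ Fin n, (3 * ((d - 5 - 3 * k : ℕ) : ℝ)) ^ k ≤
      ∑ f : Fin k → Fin (d + 1), ((Finset.univ.filter fun G : SimpleGraph (Fin n) =>
        IsSnakePartition G d fun v => ((Sum.elim id f ∘ (E s).symm) v : ℕ)).card : ℝ) /
        ∏ i, (1 + ((Finset.univ.filter fun b => f b = i).card : ℝ)) := by
    intro s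
    calc _ ≤ ((Finset.univ.filter fun f : Fin k → Fin (d + 1) => IsSpread d f).card : ℝ) *
          3 ^ k := by
          rw [mul_pow, mul_comm]
          gcongr
          exact_mod_cast le_card_isSpread k d k le_rfl
      _ = ∑ f ∈ Finset.univ.filter (fun f : Fin k → Fin (d + 1) => IsSpread d f), (3 : ℝ) ^ k := by
          rw [Finset.sum_const, nsmul_eq_mul]
      _ ≤ ∑ f ∈ Finset.univ.filter (fun f : Fin k → Fin (d + 1) => IsSpread d f),
          ((Finset.univ.filter fun G : SimpleGraph (Fin n) =>
            IsSnakePartition G d fun v => ((Sum.elim id f ∘ (E s).symm) v : ℕ)).card : ℝ) /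
          ∏ i, (1 + ((Finset.univ.filter fun b => f b = i).card : ℝ)) := by
          refine Finset.sum_le_sum fun f hf => ?_
          have hf' : IsSpread d f := (Finset.mem_filter.1 hf).2
          rw [prod_one_add_occ, le_div_iff₀]
          · have h2 := le_layerWeight d (occ f)
              (fun i => by have := hf'.occ_add_occ_le i; omega) (hf'.occ_eq_zero (by omega))
            rw [sum_occ, ← card_isLayered_sumElim (E s) f] at h2
            have h3 := h2.trans (Finset.card_le_card
              (t := Finset.univ.filter fun G : SimpleGraph (Fin n) =>
                IsSnakePartition G d fun v => ((Sum.elim id f ∘ (E s).symm) v : ℕ))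
              fun G hG => Finset.mem_filter.2 ⟨Finset.mem_univ _,
                (Finset.mem_filter.1 hG).2.isSnakePartition
                  (fun v => Nat.lt_succ_iff.1 (Fin.is_lt _)) hf'
                  fun i hi => card_part_sumElim (E s) f hi⟩)
            rw [mul_comm]
            exact_mod_cast h3
          · exact_mod_cast Finset.prod_pos fun i _ => by omega
      _ ≤ _ := Finset.sum_le_sum_of_subset_of_nonneg (Finset.filter_subset _ _)
          fun f _ _ => by positivity
  calc _ = ∑ _s : Fin (d + 1) ↪ Fin n, (3 * ((d - 5 - 3 * k : ℕ) : ℝ)) ^ k := by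
        rw [Finset.sum_const, Finset.card_univ, Fintype.card_embedding_eq, nsmul_eq_mul]
        simp
    _ ≤ _ := Finset.sum_le_sum fun s _ => h1 s

theorem le_two_mul_ncard_snakeGraphs {n k d : ℕ} (hn : n = d + 1 + k) :
    (n.descFactorial (d + 1) : ℝ) * (3 * (d - 5 - 3 * k : ℕ)) ^ k ≤
      2 * ((snakeGraphs n d).ncard : ℝ) := by
  refine (le_sum_card_isSnakePartition hn).trans ?_
  exact_mod_cast sum_card_isSnakePartition_le n d

/-- Consecutive terms grow by a factor at least 2, so the terms before the last sum to at most twice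
the penultimate one, which is k / x times the last. -/
theorem sum_pow_div_factorial_le {x : ℝ} (k : ℕ) (hx : 0 < x) (hk : 2 * (k : ℝ) ≤ x) :
    ∑ j ∈ Finset.range (k + 1), x ^ j / (j.factorial : ℝ) ≤
      (1 + 2 * k / x) * (x ^ k / (k.factorial : ℝ)) := by
  induction k with
  | zero => simp
  | succ k ih =>
    push_cast at hk
    have ih' := ih (by linarith)
    rw [Finset.sum_range_succ]
    have h1 : x ^ k / (k.factorial : ℝ) =
        (k + 1) / x * (x ^ (k + 1) / ((k + 1).factorial : ℝ)) := by
      rw [Nat.factorial_succ, pow_succ]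
      push_cast
      field_simp
    have h2 : (1 + 2 * k / x) ≤ 2 := by
      have : 2 * k / x ≤ 1 := (div_le_one hx).2 (by linarith)
      linarith
    have h3 : 0 ≤ x ^ k / (k.factorial : ℝ) := by positivity
    calc _ ≤ 2 * (x ^ k / (k.factorial : ℝ)) + x ^ (k + 1) / ((k + 1).factorial : ℝ) := by
          gcongr
          exact ih'.trans (by gcongr)
      _ = _ := by
          rw [h1]
          push_cast
          ring

theorem two_mul_ncard_graphsDiamGe_le_mul {n k d : ℕ} (hn : n = d + 1 + k) (hd : 1 ≤ d)
    (hkn : 2 * k ≤ n) :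
    2 * ((graphsDiamGe n d).ncard : ℝ) ≤
      (1 + 2 * k / n) * (n.descFactorial (d + 1) * (3 * (n + 3 * k * 9 ^ k)) ^ k) := by
  classical
  set x : ℝ := 3 * (n + 3 * k * 9 ^ k) with hx
  have hn0 : (0 : ℝ) < n := by exact_mod_cast (by omega : 0 < n)
  have hkn' : 2 * (k : ℝ) ≤ n := by exact_mod_cast hkn
  have hxn : (n : ℝ) ≤ x := by
    have : (0 : ℝ) ≤ k * 9 ^ k := by positivity
    rw [hx]
    nlinarith
  have hx0 : 0 < x := hn0.trans_le hxn
  have h1 : 2 * ((graphsDiamGe n d).ncard : ℝ) ≤ ∑ m ∈ Finset.Ico d n,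
      ∑ ℓ ∈ Finset.univ.filter (fun ℓ : Fin n → Fin (m + 1) => Function.Surjective ℓ),
        ((Finset.univ.filter fun G : SimpleGraph (Fin n) =>
          IsLayered G fun v => ℓ v).card : ℝ) := by
    exact_mod_cast two_mul_ncard_graphsDiamGe_le n d hd
  -- With j surplus vertices the falling factorial is n! / j!, so the sum over diameters becomes a
  -- truncated exponential series in x.
  have hdesc : ∀ j, j ≤ n → (n.descFactorial (n - j) : ℝ) = n.factorial / j.factorial := by
    intro j hj
    rw [eq_div_iff (by positivity)]
    have := Nat.factorial_mul_descFactorial (Nat.sub_le n j)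
    rw [Nat.sub_sub_self hj] at this
    rw [mul_comm]
    exact_mod_cast this
  have h2 : ∀ m ∈ Finset.Ico d n,
      ∑ ℓ ∈ Finset.univ.filter (fun ℓ : Fin n → Fin (m + 1) => Function.Surjective ℓ),
        ((Finset.univ.filter fun G : SimpleGraph (Fin n) =>
          IsLayered G fun v => ℓ v).card : ℝ) ≤
      n.factorial * (x ^ (n - 1 - m) / ((n - 1 - m).factorial : ℝ)) := by
    intro m hm
    have hm' := Finset.mem_Ico.1 hm
    refine (sum_card_isLayered_le (k := n - 1 - m) (K := k) (by omega) (by omega)).trans ?_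
    rw [show m + 1 = n - (n - 1 - m) by omega, hdesc _ (by omega), div_mul_eq_mul_div,
      mul_div_assoc]
    gcongr
    rw [hx]
    gcongr
    exact Nat.sub_le _ _
  have h3 : ∑ m ∈ Finset.Ico d n,
      (n.factorial : ℝ) * (x ^ (n - 1 - m) / ((n - 1 - m).factorial : ℝ)) =
      n.factorial * ∑ j ∈ Finset.range (k + 1), x ^ j / (j.factorial : ℝ) := by
    rw [← Finset.mul_sum]
    congr 1
    refine Finset.sum_nbij' (fun m => n - 1 - m) (fun j => n - 1 - j) ?_ ?_ ?_ ?_ ?_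
    · intro m hm
      simp only [Finset.mem_Ico, Finset.mem_range] at hm ⊢
      omega
    · intro m hm
      simp only [Finset.mem_Ico, Finset.mem_range] at hm ⊢
      omega
    · intro m hm
      simp only [Finset.mem_Ico] at hm
      omega
    · intro m hm
      simp only [Finset.mem_range] at hm
      omega
    · intro m _
      rfl
  calc _ ≤ _ := h1
    _ ≤ _ := Finset.sum_le_sum h2
    _ = _ := h3
    _ ≤ n.factorial * ((1 + 2 * k / x) * (x ^ k / (k.factorial : ℝ))) := by
        gcongr
        exact sum_pow_div_factorial_le k hx0 (hkn'.trans hxn)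
    _ ≤ n.factorial * ((1 + 2 * k / n) * (x ^ k / (k.factorial : ℝ))) := by gcongr
    _ = _ := by
        rw [show d + 1 = n - k by omega, hdesc k (by omega)]
        ring

/-! ### Asymptotics. -/

theorem tendsto_one_add_log_sq_div_sqrt :
    Filter.Tendsto (fun n : ℕ => 10 * ((1 + Real.log (n : ℝ)) ^ 2 / √(n : ℝ))) Filter.atTop
      (nhds 0) := by
  have h1 : (fun x : ℝ => 1 + Real.log x) =o[Filter.atTop] fun x : ℝ => x ^ (1 / 4 : ℝ) := by
    refine Asymptotics.IsLittleO.add ?_ (isLittleO_log_rpow_atTop (by norm_num))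
    refine (Asymptotics.isLittleO_const_left_of_ne one_ne_zero).2 ?_
    exact tendsto_norm_atTop_atTop.comp (tendsto_rpow_atTop (by norm_num))
  have h2 := (h1.pow (n := 2) (by norm_num)).tendsto_div_nhds_zero
  have h3 : Filter.Tendsto (fun x : ℝ => (1 + Real.log x) ^ 2 / √x) Filter.atTop (nhds 0) := by
    refine h2.congr' ?_
    filter_upwards [Filter.eventually_ge_atTop 0] with x hx
    rw [← Real.rpow_natCast (x ^ (1 / 4 : ℝ)), ← Real.rpow_mul hx, Real.sqrt_eq_rpow]
    norm_num
  simpa using (h3.comp tendsto_natCast_atTop_atTop).const_mul 10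

/-- Bernoulli's inequality absorbs the loss from d to d - 5 - 3k in the k-th power. -/
theorem le_ncard_snakeGraphs {n k d : ℕ} {δ : ℝ} (hn : n = d + 1 + k) (hd : 5 + 3 * k ≤ d)
    (hδ : (k : ℝ) * (5 + 3 * k) ≤ δ * d) :
    (1 - δ) * snakeCount n d ≤ ((snakeGraphs n d).ncard : ℝ) := by
  have h := le_two_mul_ncard_snakeGraphs hn
  have hd0 : (0 : ℝ) < d := by exact_mod_cast (by omega : 0 < d)
  have hd' : (5 + 3 * k : ℝ) ≤ d := by exact_mod_cast hd
  have hcast : ((d - 5 - 3 * k : ℕ) : ℝ) = d * (1 + -((5 + 3 * k) / d)) := by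
    rw [Nat.sub_sub, Nat.cast_sub hd]
    push_cast
    field_simp
    ring
  have hb : 1 - δ ≤ (1 + -((5 + 3 * k : ℝ) / d)) ^ k := by
    refine le_trans ?_ (one_add_mul_le_pow ?_ k)
    · have : (k : ℝ) * ((5 + 3 * k) / d) ≤ δ := by
        rw [mul_div_assoc']
        exact (div_le_iff₀ hd0).2 hδ
      linarith
    · have := (div_le_one hd0).2 hd'
      linarith
  have hk : n - d - 1 = k := by omega
  rw [hcast, mul_pow, mul_pow] at h
  unfold snakeCount
  rw [hk]
  have h2 := mul_le_mul_of_nonneg_left hb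
    (show (0 : ℝ) ≤ 1 / 2 * (n.descFactorial (d + 1) : ℝ) * (d : ℝ) ^ k * 3 ^ k by positivity)
  linarith

theorem ncard_graphsDiamGe_le {n k d : ℕ} {δ : ℝ} (hn : n = d + 1 + k) (hd : 1 ≤ d)
    (hkn : 2 * k ≤ n) (hδ₁ : 2 * (k : ℝ) ≤ δ * n)
    (hδ₂ : (k : ℝ) * (k + 1 + 3 * k * 9 ^ k) ≤ δ * d) :
    ((graphsDiamGe n d).ncard : ℝ) ≤ Real.exp (2 * δ) * snakeCount n d := by
  have h := two_mul_ncard_graphsDiamGe_le_mul hn hd hkn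
  have hd0 : (0 : ℝ) < d := by exact_mod_cast hd
  have hn0 : (0 : ℝ) < n := by exact_mod_cast (by omega : 0 < n)
  have hk : n - d - 1 = k := by omega
  have h1 : 1 + 2 * (k : ℝ) / n ≤ Real.exp δ := by
    have h2 : 2 * (k : ℝ) / n ≤ δ := (div_le_iff₀ hn0).2 hδ₁
    have h3 := Real.add_one_le_exp δ
    linarith
  have h2 : (n + 3 * k * 9 ^ k : ℝ) = d * (1 + (k + 1 + 3 * k * 9 ^ k) / d) := by
    rw [hn]
    push_cast
    field_simp
    ring
  have h3 : (1 + (k + 1 + 3 * k * 9 ^ k : ℝ) / d) ^ k ≤ Real.exp δ := by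
    have h4 : (1 + (k + 1 + 3 * k * 9 ^ k : ℝ) / d) ≤ Real.exp ((k + 1 + 3 * k * 9 ^ k : ℝ) / d) := by
      rw [add_comm]
      exact Real.add_one_le_exp _
    calc _ ≤ Real.exp ((k + 1 + 3 * k * 9 ^ k : ℝ) / d) ^ k :=
          pow_le_pow_left₀ (by positivity) h4 k
      _ = Real.exp (k * ((k + 1 + 3 * k * 9 ^ k : ℝ) / d)) := (Real.exp_nat_mul _ _).symm
      _ ≤ _ := by
          rw [Real.exp_le_exp, mul_div_assoc']
          exact (div_le_iff₀ hd0).2 hδ₂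
  rw [h2, mul_pow, mul_pow] at h
  have h5 := mul_le_mul h1 h3 (by positivity) (Real.exp_pos _).le
  rw [← Real.exp_add, ← two_mul] at h5
  have h6 := mul_le_mul_of_nonneg_left h5
    (show (0 : ℝ) ≤ 1 / 2 * (n.descFactorial (d + 1) : ℝ) * (d : ℝ) ^ k * 3 ^ k by positivity)
  unfold snakeCount
  rw [hk]
  linarith

/-- This fixes the constant 1/16: log 9 ≤ 8, so the exponent is at most half of log n. -/
theorem nine_pow_le_sqrt {n k : ℕ} (hn : 1 ≤ n) (hk : (k : ℝ) ≤ 1 / 16 * Real.log n) :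
    (9 : ℝ) ^ k ≤ √(n : ℝ) := by
  have hn0 : (0 : ℝ) < n := by exact_mod_cast hn
  have h9 : Real.log 9 ≤ 8 := by
    have := Real.log_le_sub_one_of_pos (show (0 : ℝ) < 9 by norm_num)
    linarith
  rw [← Real.rpow_natCast, Real.rpow_def_of_pos (by norm_num), Real.sqrt_eq_rpow,
    Real.rpow_def_of_pos hn0, Real.exp_le_exp]
  have := mul_le_mul_of_nonneg_right h9 (Nat.cast_nonneg (α := ℝ) k)
  linarith

theorem theorem2 :
    ∃ c₂ : ℝ, 0 < c₂ ∧ ∀ ε : ℝ, 0 < ε → ∃ N : ℕ, ∀ n d : ℕ, N ≤ n →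
      (n : ℝ) - c₂ * Real.log (n : ℝ) < (d : ℝ) → d < n →
        (1 - ε) * ((graphsDiamGe n d).ncard : ℝ) ≤
            ((graphsDiamGe n d ∩ snakeGraphs n d).ncard : ℝ) ∧
          |((graphsDiamEq n d).ncard : ℝ) - snakeCount n d| ≤ ε * snakeCount n d := by
  refine ⟨1 / 16, by norm_num, fun ε hε => ?_⟩
  have hlim := tendsto_one_add_log_sq_div_sqrt
  have hexp : Filter.Tendsto (fun n : ℕ => Real.exp (2 * (10 * ((1 + Real.log (n : ℝ)) ^ 2 /
      √(n : ℝ))))) Filter.atTop (nhds 1) := by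
    have := (Real.continuous_exp.tendsto _).comp (hlim.const_mul 2)
    simpa [Function.comp_def] using this
  obtain ⟨N, hN⟩ := Filter.eventually_atTop.1
    -- The bound ε/2 controls the error; the bound 1/2 gives √n ≥ 20 (1 + log n)², the source of
    -- size conditions such as n ≤ 2d.
    ((hlim.eventually_le_const (show (0 : ℝ) < min (ε / 2) (1 / 2) by positivity)).and
    (hexp.eventually_le_const (show (1 : ℝ) < 1 + ε / 2 by linarith)))
  refine ⟨max N 100, fun n d hn hnd hdn => ?_⟩
  obtain ⟨hδ, hδexp⟩ := hN n (le_of_max_le_left hn)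
  have hn100 : 100 ≤ n := le_of_max_le_right hn
  -- Chosen to dominate every relative error: the largest, k(k + 1 + 3k·9^k)/d, is at most 4(1 +
  -- L)²s/d, and d ≥ n/2.
  set δ := 10 * ((1 + Real.log (n : ℝ)) ^ 2 / √(n : ℝ)) with hδdef
  have hδε : δ ≤ ε / 2 := hδ.trans (min_le_left _ _)
  have hδ2 : δ ≤ 1 / 2 := hδ.trans (min_le_right _ _)
  obtain ⟨k, hk⟩ : ∃ k, n = d + 1 + k := ⟨n - d - 1, by omega⟩
  have hnk : (n : ℝ) = d + 1 + k := by exact_mod_cast hk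
  have hn1 : (100 : ℝ) ≤ n := by exact_mod_cast hn100
  set L := Real.log (n : ℝ) with hL
  set s := √(n : ℝ) with hs
  have hL0 : 0 ≤ L := Real.log_nonneg (by linarith)
  have hss : s * s = n := Real.mul_self_sqrt (by linarith)
  have hs1 : 1 ≤ s := Real.one_le_sqrt.2 (by linarith)
  have hkL : (k : ℝ) ≤ 1 / 16 * L := by linarith
  have hk0 : (0 : ℝ) ≤ k := Nat.cast_nonneg k
  have h9 : (9 : ℝ) ^ k ≤ s := nine_pow_le_sqrt (by omega) hkL
  have hδs : δ * s = 10 * (1 + L) ^ 2 := by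
    rw [hδdef]
    field_simp
  have hδ0 : 0 ≤ δ := by positivity
  have hLsq : 1 + L ≤ (1 + L) ^ 2 := le_self_pow₀ (by linarith) two_ne_zero
  have hLs : 20 * (1 + L) ^ 2 ≤ s := by
    have := mul_le_mul_of_nonneg_right hδ2 (zero_le_one.trans hs1)
    linarith
  have hLn : 20 * (1 + L) ≤ n := by
    have : s * 1 ≤ s * s := mul_le_mul_of_nonneg_left hs1 (zero_le_one.trans hs1)
    linarith
  have hdn2 : (n : ℝ) ≤ 2 * d := by linarith
  have hδn : 10 * (1 + L) ^ 2 * s = δ * n := by rw [← hss, ← hδs]; ring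
  have hδd : 5 * (1 + L) ^ 2 * s ≤ δ * d := by
    have := mul_le_mul_of_nonneg_left hdn2 hδ0
    linarith
  have hk1 : (k : ℝ) ≤ 1 + L := by linarith
  have h5d : 5 + 3 * k ≤ d := by
    have : (5 + 3 * k : ℝ) ≤ d := by linarith
    exact_mod_cast this
  have h2kn : 2 * k ≤ n := by omega
  have hq : (1 + L) ^ 2 ≤ (1 + L) ^ 2 * s := le_mul_of_one_le_right (by positivity) hs1
  have hlow : (1 - δ) * snakeCount n d ≤ ((snakeGraphs n d).ncard : ℝ) := by
    refine le_ncard_snakeGraphs hk h5d (le_trans ?_ hδd)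
    have : (k : ℝ) * (5 + 3 * k) ≤ (1 + L) * (5 * (1 + L)) :=
      mul_le_mul hk1 (by linarith) (by positivity) (by linarith)
    linarith
  have hup : ((graphsDiamGe n d).ncard : ℝ) ≤ Real.exp (2 * δ) * snakeCount n d := by
    refine ncard_graphsDiamGe_le hk (by omega) h2kn ?_ (le_trans ?_ hδd)
    · rw [← hδn]
      linarith
    · have h1 : (k : ℝ) * 9 ^ k ≤ (1 + L) * s := mul_le_mul hk1 h9 (by positivity) (by linarith)
      have h2 : (k : ℝ) + 1 ≤ (1 + L) * s := by
        have : (1 + L) * 1 ≤ (1 + L) * s := mul_le_mul_of_nonneg_left hs1 (by linarith)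
        linarith
      calc (k : ℝ) * (k + 1 + 3 * k * 9 ^ k) ≤ (1 + L) * (4 * ((1 + L) * s)) :=
            mul_le_mul hk1 (by linarith) (by positivity) (by linarith)
        _ = 4 * ((1 + L) ^ 2 * s) := by ring
        _ ≤ 5 * (1 + L) ^ 2 * s := by linarith
  have hT : 0 ≤ snakeCount n d := by unfold snakeCount; positivity
  have hup' : ((graphsDiamGe n d).ncard : ℝ) ≤ (1 + ε / 2) * snakeCount n d :=
    hup.trans (mul_le_mul_of_nonneg_right hδexp hT)
  have hlow' : (1 - ε / 2) * snakeCount n d ≤ ((snakeGraphs n d).ncard : ℝ) :=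
    le_trans (mul_le_mul_of_nonneg_right (by linarith) hT) hlow
  have hsub := snakeGraphs_subset_graphsDiamEq n d
  have hsub' := graphsDiamEq_subset_graphsDiamGe n d
  constructor
  · rw [Set.inter_eq_right.2 (hsub.trans hsub')]
    -- For ε ≤ 1 use (1 - ε)(1 + ε/2) ≤ 1 - ε/2; for ε ≥ 1 the left side is nonpositive.
    rcases le_total ε 1 with h1 | h1
    · refine le_trans ?_ hlow'
      have := mul_le_mul_of_nonneg_left hup' (sub_nonneg.2 h1)
      have h2 := mul_nonneg (mul_nonneg hε.le hε.le) hT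
      linarith
    · exact (mul_nonpos_of_nonpos_of_nonneg (by linarith) (Nat.cast_nonneg _)).trans
        (Nat.cast_nonneg _)
  · have h1 : ((snakeGraphs n d).ncard : ℝ) ≤ (graphsDiamEq n d).ncard := by
      exact_mod_cast Set.ncard_le_ncard hsub (Set.toFinite _)
    have h2 : ((graphsDiamEq n d).ncard : ℝ) ≤ (graphsDiamGe n d).ncard := by
      exact_mod_cast Set.ncard_le_ncard hsub' (Set.toFinite _)
    have h3 := mul_nonneg hε.le hT
    rw [abs_le]
    constructor <;> linarith
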